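/- Let $N\ge 2$ and let $y_1,\dots,y_N$ be i.i.d. real random variables with law $\mathcal N(a,\sigma^2)$, where $a\in\mathbb R$ and $\sigma^2>0$ are unknown. Consider testing $\mathcal H_0: a=0$ against $\mathcal H_1: a\neq 0$. For a sample $y=(y_1,\dots,y_N)$ with mean $\bar y=\frac1N\sum_k y_k$ put $$L(y)=\frac{(N-1)\left(\sum_{k=1}^N y_k\right)^2}{N\sum_{k=1}^N (y_k-\bar y)^2},\qquad p(y;\mu,v)=\prod_{k=1}^N\frac{1}{\sqrt{2\pi v}}\,e^{-(y_k-\mu)^2/(2v)},\qquad \Lambda(y)=\frac{\sup_{\mu\neq 0,\ v>0}p(y;\mu,v)}{\sup_{v>0}p(y;0,v)}.$$ 1. ($L$ is the generalized likelihood ratio test statistic.) For every $y\in\mathbb R^N$ whose coordinates are not all equal, both suprema are finite, the denominator of $\Lambda(y)$ is positive, and $$L(y)=(N-1)\left(\Lambda(y)^{2/N}-1\right).$$ Hence, for every threshold $b\ge 0$, $L(y)>b$ if and only if $\Lambda(y)>\left(1+\frac{b}{N-1}\right)^{N/2}$. The random sample almost surely has coordinates that are not all equal. 2. (Distribution of $L$.)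 Under $\mathcal H_0$, $L(y_1,\dots,y_N)$ has the central Fisher–Snedecor distribution $F(1,N-1)$. Under $\mathcal H_1$, it has the noncentral Fisher–Snedecor distribution $F'\!\left(1,N-1,\frac{N a^2}{\sigma^2}\right)$. Here $\chi^2_d$ is the law of $\sum_{i=1}^d Z_i^2$ with $Z_i$ independent $\mathcal N(0,1)$; $\chi'^2_d(\lambda)$ is the law of $\sum_{i=1}^d X_i^2$ with $X_i$ independent $\mathcal N(\mu_i,1)$ and $\sum_i\mu_i^2=\lambda$; $F(d_1,d_2)$ and $F'(d_1,d_2,\lambda)$ are the laws of $\frac{X_1/d_1}{X_2/d_2}$ with $X_1,X_2$ independent, $X_2\sim\chi^2_{d_2}$, and $X_1\sim\chi^2_{d_1}$, respectively $X_1\sim\chi'^2_{d_1}(\lambda)$. -/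

import Mathlib

open MeasureTheory ProbabilityTheory
open scoped NNReal

namespace GLRT

noncomputable section

/-- The statistic
`(n - 1) (∑ y_k)² / (n ∑ (y_k - ȳ)²)` with `ȳ = (1 / n) ∑ y_k`. -/
def statistic {n : ℕ} (y : Fin n → ℝ) : ℝ :=
  (((n : ℝ) - 1) * (∑ k, y k) ^ 2) /
    ((n : ℝ) * ∑ k, (y k - (1 / (n : ℝ)) * ∑ j, y j) ^ 2)

/-- The likelihood of the parameter `θ = (mean, variance)` at the sample `y`: the joint density
at `y` of `n` independent Gaussian variables with this mean and variance. -/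
def likelihood {n : ℕ} (y : Fin n → ℝ) (θ : ℝ × ℝ≥0) : ℝ :=
  ∏ k, gaussianPDFReal θ.1 θ.2 (y k)

/-- Null hypothesis: the mean is zero; the variance is an unknown positive number. -/
def nullHypothesis : Set (ℝ × ℝ≥0) := {θ | θ.1 = 0 ∧ 0 < θ.2}

/-- Alternative: the mean is an unknown nonzero number; the variance is an unknown positive
number. -/
def altHypothesis : Set (ℝ × ℝ≥0) := {θ | θ.1 ≠ 0 ∧ 0 < θ.2}

/-- Supremum of the likelihood over a set of parameters. -/
def supLikelihood {n : ℕ} (Θ : Set (ℝ × ℝ≥0)) (y : Fin n → ℝ) : ℝ :=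
  sSup (likelihood y '' Θ)

/-- The generalized likelihood ratio: unknown parameters are maximized out under each hypothesis. -/
def likelihoodRatio {n : ℕ} (y : Fin n → ℝ) : ℝ :=
  supLikelihood altHypothesis y / supLikelihood nullHypothesis y

/-- Central chi-square distribution with `d` degrees of freedom: the law of `∑ Z_i²` for
independent standard Gaussian variables `Z_1, …, Z_d`. -/
def chiSq (d : ℕ) : Measure ℝ :=
  (Measure.pi fun _ : Fin d => gaussianReal 0 1).map fun z => ∑ i, z i ^ 2

/-- Noncentral chi-square distribution with `d` degrees of freedom and noncentrality `lam ≥ 0`: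
the law of `∑ X_i²` for independent `X_i ~ N(μ_i, 1)` with `∑ μ_i² = lam`. By rotation invariance
this law depends on the means only through `lam`; here the mean vector is `(√lam, 0, …, 0)`. -/
def noncentralChiSq (d : ℕ) (lam : ℝ) : Measure ℝ :=
  (Measure.pi fun i : Fin d => gaussianReal (if (i : ℕ) = 0 then √lam else 0) 1).map
    fun x => ∑ i, x i ^ 2

/-- Central Fisher–Snedecor distribution `F(d₁, d₂)`: the law of `(X₁ / d₁) / (X₂ / d₂)` for
independent central chi-square variables `X₁`, `X₂` with `d₁`, `d₂` degrees of freedom. -/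
def fisher (d₁ d₂ : ℕ) : Measure ℝ :=
  ((chiSq d₁).prod (chiSq d₂)).map fun x => (x.1 / (d₁ : ℝ)) / (x.2 / (d₂ : ℝ))

/-- Noncentral Fisher–Snedecor distribution `F'(d₁, d₂, lam)`: the law of
`(X₁ / d₁) / (X₂ / d₂)` for independent `X₁`, `X₂`, where `X₁` is noncentral chi-square with `d₁`
degrees of freedom and noncentrality `lam`, and `X₂` is central chi-square with `d₂` degrees of
freedom. -/
def noncentralFisher (d₁ d₂ : ℕ) (lam : ℝ) : Measure ℝ :=
  ((noncentralChiSq d₁ lam).prod (chiSq d₂)).map fun x => (x.1 / (d₁ : ℝ)) / (x.2 / (d₂ : ℝ))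

end

end GLRT

/-!
Let `D(μ)` be the mean square deviation of the sample from `μ`. The likelihood of `(μ, v)` is
`exp (-(n / 2) (log (2πv) + D(μ) / v))`, which is largest at `v = D(μ)`; hence the two suprema are
governed by `D(0)` and by `min D = D(ȳ)`, and `Λ = (D(0) / D(ȳ)) ^ (n / 2)`. Since
`D(0) = D(ȳ) + ȳ²`, this is `(1 + L / (n - 1)) ^ (n / 2)`.

Independent Gaussians with a common variance `σ²` stay independent with variance `σ²` under a linear
isometry, which transforms the mean vector. An isometry sending `(1, …, 1)` to `√n` times a
coordinate vector turns `√n ȳ` into that coordinate of the sample and `n D(ȳ)` into the sum of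
squares of the others, which have mean zero. So `L` is an `F`-ratio with noncentrality
`(√n a / σ)²`.
-/

namespace GLRT

open WithLp (toLp)
open scoped RealInnerProductSpace
open scoped BigOperators

section MeanSquareDeviation

variable {ι : Type*} [Fintype ι]

/-- The mean square deviation of the sample `y` from `μ`, normalized by the sample size (so that it
is the maximum likelihood estimate of a Gaussian variance when the mean is known to be `μ`). -/
noncomputable def meanSqDev (y : ι → ℝ) (μ : ℝ) : ℝ := 𝔼 k, (y k - μ) ^ 2

theorem sum_sub_sq_eq_card_mul (y : ι → ℝ) (μ : ℝ) :
    ∑ k, (y k - μ) ^ 2 = Fintype.card ι * meanSqDev y μ :=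
  (Fintype.card_mul_expect _).symm

theorem meanSqDev_eq_add_sq [Nonempty ι] (y : ι → ℝ) (μ : ℝ) :
    meanSqDev y μ = meanSqDev y (𝔼 k, y k) + ((𝔼 k, y k) - μ) ^ 2 := by
  have expand (c : ℝ) : meanSqDev y c = 𝔼 k, y k ^ 2 - 2 * (𝔼 k, y k) * c + c ^ 2 := by
    simp only [meanSqDev, sub_sq, Finset.expect_add_distrib, Finset.expect_sub_distrib,
      Fintype.expect_const, Finset.mul_expect, Finset.expect_mul]
  rw [expand, expand]
  ring

theorem meanSqDev_expect_le [Nonempty ι] (y : ι → ℝ) (μ : ℝ) :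
    meanSqDev y (𝔼 k, y k) ≤ meanSqDev y μ := by
  rw [meanSqDev_eq_add_sq y μ]
  exact le_add_of_nonneg_right (sq_nonneg _)

theorem meanSqDev_pos {y : ι → ℝ} (hy : ∃ i j, y i ≠ y j) (μ : ℝ) : 0 < meanSqDev y μ := by
  obtain ⟨k, hk⟩ : ∃ k, y k ≠ μ := by
    by_contra! h
    obtain ⟨i, j, hij⟩ := hy
    exact hij ((h i).trans (h j).symm)
  exact Finset.expect_pos' (fun _ _ => sq_nonneg _)
    ⟨k, Finset.mem_univ k, sq_pos_of_ne_zero (sub_ne_zero.mpr hk)⟩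

end MeanSquareDeviation

section MaximumLikelihood

/-- The Gaussian log-likelihood per observation, as a function of the mean square deviation `s` of
the sample from the mean parameter and of the variance parameter `v`. -/
noncomputable def meanLogLikelihood (s v : ℝ) : ℝ := -(Real.log (2 * Real.pi * v) + s / v) / 2

theorem meanLogLikelihood_anti {s t v : ℝ} (hv : 0 ≤ v) (hst : s ≤ t) :
    meanLogLikelihood t v ≤ meanLogLikelihood s v := by
  unfold meanLogLikelihood
  gcongr

theorem meanLogLikelihood_le_self {s v : ℝ} (hs : 0 < s) (hv : 0 < v) :
    meanLogLikelihood s v ≤ meanLogLikelihood s s := by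
  have hlog : Real.log s - Real.log v ≤ s / v - 1 := by
    rw [← Real.log_div hs.ne' hv.ne']
    exact Real.log_le_sub_one_of_pos (div_pos hs hv)
  have hpi : 2 * Real.pi ≠ 0 := by positivity
  rw [meanLogLikelihood, meanLogLikelihood, Real.log_mul hpi hv.ne', Real.log_mul hpi hs.ne',
    div_self hs.ne']
  linarith

theorem exp_mul_meanLogLikelihood_self_div (x : ℝ) {s t : ℝ} (hs : 0 < s) (ht : 0 < t) :
    Real.exp (x * meanLogLikelihood s s) / Real.exp (x * meanLogLikelihood t t) =
      (t / s) ^ (x / 2) := by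
  have hpi : 2 * Real.pi ≠ 0 := by positivity
  rw [← Real.exp_sub, Real.rpow_def_of_pos (div_pos ht hs), Real.log_div ht.ne' hs.ne',
    meanLogLikelihood, meanLogLikelihood, Real.log_mul hpi hs.ne', Real.log_mul hpi ht.ne',
    div_self hs.ne', div_self ht.ne']
  ring_nf

theorem gaussianPDFReal_eq_exp (μ : ℝ) {v : ℝ≥0} (hv : 0 < v) (x : ℝ) :
    gaussianPDFReal μ v x = Real.exp (meanLogLikelihood ((x - μ) ^ 2) v) := by
  have hv' : (0 : ℝ) < 2 * Real.pi * v := by positivity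
  have hsqrt : (√(2 * Real.pi * v))⁻¹ = Real.exp (-Real.log (2 * Real.pi * v) / 2) := by
    rw [neg_div, Real.exp_neg, Real.exp_half, Real.exp_log hv']
  rw [gaussianPDFReal, hsqrt, ← Real.exp_add, meanLogLikelihood]
  ring_nf

variable {n : ℕ} {y : Fin n → ℝ}

theorem likelihood_eq_exp (y : Fin n → ℝ) {θ : ℝ × ℝ≥0} (hθ : 0 < θ.2) :
    likelihood y θ = Real.exp (n * meanLogLikelihood (meanSqDev y θ.1) θ.2) := by
  simp only [likelihood, gaussianPDFReal_eq_exp _ hθ, ← Real.exp_sum, meanLogLikelihood,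
    ← Finset.sum_div, Finset.sum_neg_distrib, Finset.sum_add_distrib, Finset.sum_const,
    Finset.card_univ, Fintype.card_fin, nsmul_eq_mul, sum_sub_sq_eq_card_mul]
  ring_nf

theorem isLUB_likelihood_image_prod {M : Set ℝ} {m : ℝ} (hm : m ∈ closure M)
    (hmin : ∀ μ ∈ M, meanSqDev y m ≤ meanSqDev y μ) (hpos : 0 < meanSqDev y m) :
    IsLUB (likelihood y '' M ×ˢ Set.Ioi 0)
      (Real.exp (n * meanLogLikelihood (meanSqDev y m) (meanSqDev y m))) := by
  refine ⟨?_, fun B hB => ?_⟩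
  · rintro _ ⟨θ, ⟨hθM, hθ⟩, rfl⟩
    have hv : (0 : ℝ) < θ.2 := hθ
    rw [likelihood_eq_exp y hθ]
    gcongr
    exact (meanLogLikelihood_anti hv.le (hmin _ hθM)).trans (meanLogLikelihood_le_self hpos hv)
  · let v : ℝ≥0 := ⟨meanSqDev y m, hpos.le⟩
    have hcont : Continuous fun μ => likelihood y (μ, v) := by
      simp only [likelihood, gaussianPDFReal]
      fun_prop
    have hle : closure M ⊆ {μ | likelihood y (μ, v) ≤ B} :=
      closure_minimal (fun μ hμ => hB ⟨(μ, v), ⟨hμ, hpos⟩, rfl⟩)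
        (isClosed_le hcont continuous_const)
    have hmB : likelihood y (m, v) ≤ B := hle hm
    rwa [likelihood_eq_exp y (θ := (m, v)) hpos] at hmB

theorem isLUB_likelihood_nullHypothesis (hy : ∃ i j, y i ≠ y j) :
    IsLUB (likelihood y '' nullHypothesis)
      (Real.exp (n * meanLogLikelihood (meanSqDev y 0) (meanSqDev y 0))) :=
  isLUB_likelihood_image_prod (M := {0}) (subset_closure rfl) (by simp) (meanSqDev_pos hy 0)

-- The sample mean may be `0`, hence not attained: the alternative is only dense among all means.
theorem isLUB_likelihood_altHypothesis (hy : ∃ i j, y i ≠ y j) :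
    IsLUB (likelihood y '' altHypothesis)
      (Real.exp (n * meanLogLikelihood (meanSqDev y (𝔼 k, y k)) (meanSqDev y (𝔼 k, y k)))) :=
  have : Nonempty (Fin n) := ⟨hy.choose⟩
  isLUB_likelihood_image_prod (M := {0}ᶜ) (dense_compl_singleton 0 _)
    (fun μ _ => meanSqDev_expect_le y μ) (meanSqDev_pos hy _)

theorem supLikelihood_nullHypothesis (hy : ∃ i j, y i ≠ y j) :
    supLikelihood nullHypothesis y =
      Real.exp (n * meanLogLikelihood (meanSqDev y 0) (meanSqDev y 0)) :=
  (isLUB_likelihood_nullHypothesis hy).csSup_eq (Set.Nonempty.image _ ⟨(0, 1), rfl, one_pos⟩)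

theorem supLikelihood_altHypothesis (hy : ∃ i j, y i ≠ y j) :
    supLikelihood altHypothesis y =
      Real.exp (n * meanLogLikelihood (meanSqDev y (𝔼 k, y k)) (meanSqDev y (𝔼 k, y k))) :=
  (isLUB_likelihood_altHypothesis hy).csSup_eq
    (Set.Nonempty.image _ ⟨(1, 1), one_ne_zero, one_pos⟩)

theorem likelihoodRatio_eq_rpow (hy : ∃ i j, y i ≠ y j) :
    likelihoodRatio y = (meanSqDev y 0 / meanSqDev y (𝔼 k, y k)) ^ ((n : ℝ) / 2) := by
  rw [likelihoodRatio, supLikelihood_nullHypothesis hy, supLikelihood_altHypothesis hy,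
    exp_mul_meanLogLikelihood_self_div _ (meanSqDev_pos hy _) (meanSqDev_pos hy 0)]

end MaximumLikelihood

section Statistic

variable {n : ℕ} {y : Fin n → ℝ}

theorem statistic_eq_div_meanSqDev (y : Fin n → ℝ) :
    statistic y = ((n : ℝ) - 1) * (𝔼 k, y k) ^ 2 / meanSqDev y (𝔼 k, y k) := by
  rcases Nat.eq_zero_or_pos n with rfl | hn
  · simp [statistic]
  · have hmean : (1 / (n : ℝ)) * ∑ k, y k = 𝔼 k, y k := by
      rw [Fintype.expect_eq_sum_div_card, Fintype.card_fin, one_div_mul_eq_div]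
    have hsum : ∑ k, y k = n * 𝔼 k, y k := by simpa using (Fintype.card_mul_expect y).symm
    rw [statistic, hmean, hsum, sum_sub_sq_eq_card_mul, Fintype.card_fin]
    field_simp

theorem one_lt_of_exists_ne (hy : ∃ i j, y i ≠ y j) : (1 : ℝ) < n := by
  obtain ⟨i, j, hij⟩ := hy
  exact_mod_cast Fin.nontrivial_iff_two_le.mp ⟨i, j, ne_of_apply_ne y hij⟩

theorem one_add_statistic_div (hy : ∃ i j, y i ≠ y j) :
    1 + statistic y / ((n : ℝ) - 1) = meanSqDev y 0 / meanSqDev y (𝔼 k, y k) := by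
  have : Nonempty (Fin n) := ⟨hy.choose⟩
  have hn : (0 : ℝ) < n - 1 := sub_pos.mpr (one_lt_of_exists_ne hy)
  have hdev := meanSqDev_pos hy (𝔼 k, y k)
  rw [statistic_eq_div_meanSqDev, meanSqDev_eq_add_sq y 0]
  field_simp
  ring

theorem likelihoodRatio_eq_one_add_statistic_rpow (hy : ∃ i j, y i ≠ y j) :
    likelihoodRatio y = (1 + statistic y / ((n : ℝ) - 1)) ^ ((n : ℝ) / 2) := by
  rw [one_add_statistic_div hy, likelihoodRatio_eq_rpow hy]

theorem one_add_statistic_div_pos (hy : ∃ i j, y i ≠ y j) :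
    0 < 1 + statistic y / ((n : ℝ) - 1) := by
  rw [one_add_statistic_div hy]
  exact div_pos (meanSqDev_pos hy 0) (meanSqDev_pos hy _)

theorem statistic_eq_likelihoodRatio_rpow (hy : ∃ i j, y i ≠ y j) :
    statistic y = ((n : ℝ) - 1) * (likelihoodRatio y ^ (2 / (n : ℝ)) - 1) := by
  have hn := one_lt_of_exists_ne hy
  have hn₁ : (n : ℝ) - 1 ≠ 0 := (sub_pos.mpr hn).ne'
  have hexp : (n : ℝ) / 2 * (2 / n) = 1 := by field_simp
  rw [likelihoodRatio_eq_one_add_statistic_rpow hy,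
    ← Real.rpow_mul (one_add_statistic_div_pos hy).le, hexp, Real.rpow_one, add_sub_cancel_left,
    mul_div_cancel₀ _ hn₁]

theorem lt_statistic_iff (hy : ∃ i j, y i ≠ y j) {b : ℝ} (hb : 0 ≤ b) :
    b < statistic y ↔ (1 + b / ((n : ℝ) - 1)) ^ ((n : ℝ) / 2) < likelihoodRatio y := by
  have hn := one_lt_of_exists_ne hy
  have hn₁ : (0 : ℝ) < n - 1 := sub_pos.mpr hn
  rw [likelihoodRatio_eq_one_add_statistic_rpow hy,
    Real.rpow_lt_rpow_iff (by positivity) (one_add_statistic_div_pos hy).le (by positivity),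
    add_lt_add_iff_left, div_lt_div_iff_of_pos_right hn₁]

end Statistic

section Rotation

theorem exists_linearIsometryEquiv_apply_eq_single {𝕜 E ι : Type*} [RCLike 𝕜]
    [NormedAddCommGroup E] [InnerProductSpace 𝕜 E] [Fintype ι] [DecidableEq ι]
    (hι : Module.finrank 𝕜 E = Fintype.card ι) (x : E) (i : ι) :
    ∃ U : E ≃ₗᵢ[𝕜] EuclideanSpace 𝕜 ι, U x = EuclideanSpace.single i (‖x‖ : 𝕜) := by
  have : FiniteDimensional 𝕜 E :=
    .of_finrank_pos (hι.symm ▸ Fintype.card_pos_iff.mpr ⟨i⟩)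
  rcases eq_or_ne x 0 with rfl | hx
  · let b := (stdOrthonormalBasis 𝕜 E).reindex (Fintype.equivOfCardEq (by simpa using hι))
    exact ⟨b.repr, by ext j; simp⟩
  · let u : E := (‖x‖⁻¹ : 𝕜) • x
    have hu : ‖u‖ = 1 := norm_smul_inv_norm hx
    have hortho : Orthonormal 𝕜 (({i} : Set ι).domRestrict fun _ => u) :=
      ⟨fun _ => hu, fun j k hjk => (hjk (Subsingleton.elim j k)).elim⟩
    obtain ⟨b, hb⟩ := hortho.exists_orthonormalBasis_extension_of_card_eq hι
    have hxb : (‖x‖ : 𝕜) • b i = x := by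
      rw [hb i rfl, smul_inv_smul₀ (by simpa using hx)]
    refine ⟨b.repr, ?_⟩
    calc b.repr x = (‖x‖ : 𝕜) • EuclideanSpace.single i 1 := by
          rw [← b.repr_self, ← map_smul, hxb]
      _ = EuclideanSpace.single i (‖x‖ : 𝕜) := by
          ext j
          simp [PiLp.single_apply, RCLike.real_smul_eq_coe_mul]

theorem sum_sq_linearIsometryEquiv_apply {ι κ : Type*} [Fintype ι] [Fintype κ]
    (U : EuclideanSpace ℝ ι ≃ₗᵢ[ℝ] EuclideanSpace ℝ κ) (x : EuclideanSpace ℝ ι) :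
    ∑ j, U x j ^ 2 = ∑ i, x i ^ 2 := by
  rw [← EuclideanSpace.real_norm_sq_eq, U.norm_map, EuclideanSpace.real_norm_sq_eq]

theorem measurePreserving_add_mul_gaussianReal (μ : ℝ) (v : ℝ≥0) :
    MeasurePreserving (fun x => μ + √v * x) (gaussianReal 0 1) (gaussianReal μ v) := by
  have hvar : NNReal.mk (√(v : ℝ) ^ 2) (sq_nonneg _) = v := NNReal.eq (Real.sq_sqrt v.coe_nonneg)
  have hscale : MeasurePreserving (√(v : ℝ) * ·) (gaussianReal 0 1) (gaussianReal 0 v) :=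
    ⟨by fun_prop, by rw [gaussianReal_map_const_mul, hvar, mul_zero, mul_one]⟩
  have hshift : MeasurePreserving (μ + ·) (gaussianReal 0 v) (gaussianReal μ v) :=
    ⟨by fun_prop, by rw [gaussianReal_map_const_add, zero_add]⟩
  exact hshift.comp hscale

theorem measurePreserving_pi_gaussianReal_zero_one {ι κ : Type*} [Fintype ι] [Fintype κ]
    (U : EuclideanSpace ℝ ι ≃ₗᵢ[ℝ] EuclideanSpace ℝ κ) :
    MeasurePreserving (fun x j => U (toLp 2 x) j) (Measure.pi fun _ => gaussianReal 0 1)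
      (Measure.pi fun _ => gaussianReal 0 1) := by
  have hι : MeasurePreserving (MeasurableEquiv.toLp 2 (ι → ℝ))
      (Measure.pi fun _ => gaussianReal 0 1) (stdGaussian (EuclideanSpace ℝ ι)) :=
    ⟨by fun_prop, map_pi_eq_stdGaussian⟩
  have hκ : MeasurePreserving (MeasurableEquiv.toLp 2 (κ → ℝ))
      (Measure.pi fun _ => gaussianReal 0 1) (stdGaussian (EuclideanSpace ℝ κ)) :=
    ⟨by fun_prop, map_pi_eq_stdGaussian⟩
  have hU : MeasurePreserving U (stdGaussian _) (stdGaussian _) :=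
    ⟨U.continuous.measurable, stdGaussian_map U⟩
  exact hκ.symm.comp (hU.comp hι)

theorem measurePreserving_pi_gaussianReal {ι κ : Type*} [Fintype ι] [Fintype κ]
    (U : EuclideanSpace ℝ ι ≃ₗᵢ[ℝ] EuclideanSpace ℝ κ) (m : ι → ℝ) (v : ℝ≥0) :
    MeasurePreserving (fun x j => U (toLp 2 x) j) (Measure.pi fun i => gaussianReal (m i) v)
      (Measure.pi fun j => gaussianReal (U (toLp 2 m) j) v) := by
  have hrot := measurePreserving_pi_gaussianReal_zero_one U
  have hdom := measurePreserving_pi _ _ fun i => measurePreserving_add_mul_gaussianReal (m i) v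
  have hcod := measurePreserving_pi _ _ fun j =>
    measurePreserving_add_mul_gaussianReal (U (toLp 2 m) j) v
  have haff : (fun x j => U (toLp 2 x) j) ∘ (fun x i => m i + √v * x i) =
      (fun y j => U (toLp 2 m) j + √v * y j) ∘ fun x j => U (toLp 2 x) j := by
    ext x j
    have hx : toLp 2 (fun i => m i + √v * x i) = toLp 2 m + √(v : ℝ) • toLp 2 x := rfl
    simp [hx]
  have hcomp := (haff ▸ hcod.comp hrot).map_of_comp hrot.measurable hdom.measurable
  rwa [hdom.map_eq] at hcomp

end Rotation

section Distributions

theorem measurePreserving_sum_sq {d : ℕ} (m : Fin d → ℝ) :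
    MeasurePreserving (fun x => ∑ i, x i ^ 2) (Measure.pi fun i => gaussianReal (m i) 1)
      (noncentralChiSq d (∑ i, m i ^ 2)) := by
  have hm : ‖toLp 2 m‖ = √(∑ i, m i ^ 2) := by simp [EuclideanSpace.norm_eq]
  obtain ⟨U, hU⟩ : ∃ U : EuclideanSpace ℝ (Fin d) ≃ₗᵢ[ℝ] EuclideanSpace ℝ (Fin d),
      ∀ i, U (toLp 2 m) i = if (i : ℕ) = 0 then √(∑ i, m i ^ 2) else 0 := by
    cases d with
    | zero => exact ⟨.refl ℝ _, fun i => i.elim0⟩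
    | succ d =>
      obtain ⟨U, hU⟩ := exists_linearIsometryEquiv_apply_eq_single (𝕜 := ℝ) (by simp)
        (toLp 2 m) (0 : Fin (d + 1))
      exact ⟨U, fun i => by simp [hU, hm, PiLp.single_apply]⟩
  have hrot := measurePreserving_pi_gaussianReal U m 1
  simp only [hU] at hrot
  have hsq : MeasurePreserving (fun x : Fin d → ℝ => ∑ i, x i ^ 2)
      (Measure.pi fun i : Fin d => gaussianReal (if (i : ℕ) = 0 then √(∑ i, m i ^ 2) else 0) 1)
      (noncentralChiSq d (∑ i, m i ^ 2)) := ⟨by fun_prop, rfl⟩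
  simpa only [Function.comp_def, sum_sq_linearIsometryEquiv_apply] using hsq.comp hrot

theorem noncentralChiSq_zero (d : ℕ) : noncentralChiSq d 0 = chiSq d := by
  simp [noncentralChiSq, chiSq]

theorem noncentralFisher_zero (d₁ d₂ : ℕ) : noncentralFisher d₁ d₂ 0 = fisher d₁ d₂ := by
  rw [noncentralFisher, noncentralChiSq_zero, fisher]

/-- The `F`-ratio of a vector split into two blocks: the mean square of the first block over the
mean square of the second. -/
noncomputable def meanSqRatio {d₁ d₂ : ℕ} (x : Fin d₁ ⊕ Fin d₂ → ℝ) : ℝ :=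
  ((∑ i, x (.inl i) ^ 2) / d₁) / ((∑ j, x (.inr j) ^ 2) / d₂)

theorem meanSqRatio_div {d₁ d₂ : ℕ} (x : Fin d₁ ⊕ Fin d₂ → ℝ) {c : ℝ} (hc : c ≠ 0) :
    meanSqRatio (fun i => x i / c) = meanSqRatio x := by
  simp only [meanSqRatio, div_pow, ← Finset.sum_div]
  field_simp

theorem measurePreserving_meanSqRatio {d₁ d₂ : ℕ} (m : Fin d₁ → ℝ) :
    MeasurePreserving meanSqRatio
      (Measure.pi fun i : Fin d₁ ⊕ Fin d₂ => gaussianReal (Sum.elim m 0 i) 1)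
      (noncentralFisher d₁ d₂ (∑ i, m i ^ 2)) := by
  have hsplit := measurePreserving_sumPiEquivProdPi
    fun i : Fin d₁ ⊕ Fin d₂ => gaussianReal (Sum.elim m 0 i) 1
  have hchi : MeasurePreserving (fun x => ∑ j, x j ^ 2)
      (Measure.pi fun _ : Fin d₂ => gaussianReal 0 1) (chiSq d₂) := ⟨by fun_prop, rfl⟩
  have hratio : MeasurePreserving (fun x : ℝ × ℝ => (x.1 / (d₁ : ℝ)) / (x.2 / (d₂ : ℝ)))
      ((noncentralChiSq d₁ (∑ i, m i ^ 2)).prod (chiSq d₂))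
      (noncentralFisher d₁ d₂ (∑ i, m i ^ 2)) := ⟨by fun_prop, rfl⟩
  exact hratio.comp (((measurePreserving_sum_sq m).prod hchi).comp hsplit)

theorem measurePreserving_gaussianReal_div (μ : ℝ) {c : ℝ≥0} (hc : c ≠ 0) :
    MeasurePreserving (· / (c : ℝ)) (gaussianReal μ (c ^ 2)) (gaussianReal (μ / c) 1) := by
  have hvar : c ^ 2 / NNReal.mk ((c : ℝ) ^ 2) (sq_nonneg _) = 1 :=
    div_self (pow_ne_zero 2 hc)
  exact ⟨by fun_prop, by rw [gaussianReal_map_div_const, hvar]⟩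

theorem meanSqRatio_eq_statistic {n : ℕ} [NeZero n]
    {U : EuclideanSpace ℝ (Fin n) ≃ₗᵢ[ℝ] EuclideanSpace ℝ (Fin 1 ⊕ Fin (n - 1))}
    (hU : U (toLp 2 1) = EuclideanSpace.single (.inl 0) √n) (y : Fin n → ℝ) :
    meanSqRatio (fun i => U (toLp 2 y) i) = statistic y := by
  have hn : (n : ℝ) ≠ 0 := NeZero.ne _
  have hcast : ((n - 1 : ℕ) : ℝ) = n - 1 := Nat.cast_pred (NeZero.pos n)
  have hmean : √n * U (toLp 2 y) (.inl 0) = n * 𝔼 k, y k :=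
    calc √n * U (toLp 2 y) (.inl 0) = ⟪U (toLp 2 1), U (toLp 2 y)⟫ := by
          simp [hU, EuclideanSpace.inner_single_left]
      _ = ∑ k, y k := by rw [U.inner_map_map]; simp [PiLp.inner_apply]
      _ = n * 𝔼 k, y k := by simpa using (Fintype.card_mul_expect y).symm
  have hmean_sq : U (toLp 2 y) (.inl 0) ^ 2 = n * (𝔼 k, y k) ^ 2 :=
    mul_left_cancel₀ hn <|
      calc n * U (toLp 2 y) (.inl 0) ^ 2 = (√n * U (toLp 2 y) (.inl 0)) ^ 2 := by
            rw [mul_pow, Real.sq_sqrt n.cast_nonneg]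
        _ = n * (n * (𝔼 k, y k) ^ 2) := by rw [hmean]; ring
  have hresidual : ∑ j, U (toLp 2 y) (.inr j) ^ 2 = n * meanSqDev y (𝔼 k, y k) := by
    have hnorm := sum_sq_linearIsometryEquiv_apply U (toLp 2 y)
    have hsum : ∑ k, y k ^ 2 = n * meanSqDev y 0 := by simpa using sum_sub_sq_eq_card_mul y 0
    rw [Fintype.sum_sum_type, Fin.sum_univ_one, hmean_sq, hsum, meanSqDev_eq_add_sq] at hnorm
    linarith
  rw [meanSqRatio, Fin.sum_univ_one, hmean_sq, hresidual, statistic_eq_div_meanSqDev, hcast,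
    Nat.cast_one, div_one, div_div_eq_mul_div, mul_assoc, mul_div_mul_left _ _ hn, mul_comm]

theorem measurePreserving_statistic {n : ℕ} [NeZero n] (a : ℝ) {σ : ℝ≥0} (hσ : σ ≠ 0) :
    MeasurePreserving statistic (Measure.pi fun _ : Fin n => gaussianReal a (σ ^ 2))
      (noncentralFisher 1 (n - 1) (n * a ^ 2 / (σ : ℝ) ^ 2)) := by
  have hdim : Module.finrank ℝ (EuclideanSpace ℝ (Fin n)) =
      Fintype.card (Fin 1 ⊕ Fin (n - 1)) := by
    rw [finrank_euclideanSpace_fin, Fintype.card_sum, Fintype.card_fin, Fintype.card_fin]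
    have := NeZero.pos n
    omega
  obtain ⟨U, hU⟩ := exists_linearIsometryEquiv_apply_eq_single hdim (toLp 2 1) (.inl 0)
  have hU₁ : U (toLp 2 1) = EuclideanSpace.single (.inl 0) √n := by
    simpa [EuclideanSpace.norm_eq] using hU
  have hmean (i : Fin 1 ⊕ Fin (n - 1)) :
      U (toLp 2 fun _ => a) i / σ = Sum.elim (fun _ => √n * a / σ) 0 i := by
    have hconst : toLp 2 (fun _ : Fin n => a) = a • toLp 2 1 := by ext; simp
    rw [hconst, map_smul, hU₁]
    cases i <;> simp [Subsingleton.elim _ (0 : Fin 1), mul_comm]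
  have hscale := measurePreserving_pi _ _ fun i =>
    measurePreserving_gaussianReal_div (U (toLp 2 fun _ => a) i) hσ
  have hratio := measurePreserving_meanSqRatio (d₂ := n - 1) fun _ : Fin 1 => √n * a / σ
  have hlam : ∑ _ : Fin 1, (√n * a / σ) ^ 2 = n * a ^ 2 / (σ : ℝ) ^ 2 := by
    rw [Fin.sum_univ_one, div_pow, mul_pow, Real.sq_sqrt n.cast_nonneg]
  simp only [hmean] at hscale
  rw [hlam] at hratio
  have hcomp := hratio.comp (hscale.comp (measurePreserving_pi_gaussianReal U _ _))
  have hstat : (fun y => meanSqRatio fun i => U (toLp 2 y) i / σ) = statistic := funext fun y =>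
    (meanSqRatio_div _ (NNReal.coe_ne_zero.mpr hσ)).trans (meanSqRatio_eq_statistic hU₁ y)
  rwa [← hstat]

theorem ae_ne_of_indepFun {Ω α : Type*} [MeasurableSpace Ω] [MeasurableSpace α] [MeasurableEq α]
    {P : Measure Ω} [IsFiniteMeasure P] {X Y : Ω → α} {μ ν : Measure α} [SFinite ν]
    [NullSingletonClass ν] (hX : HasLaw X μ P) (hY : HasLaw Y ν P) (h : X ⟂ᵢ[P] Y) :
    ∀ᵐ ω ∂P, X ω ≠ Y ω := by
  have hpair : HasLaw (fun ω => (X ω, Y ω)) (μ.prod ν) P :=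
    (indepFun_iff_hasLaw_prodMk_prod hX hY).mp h
  have hne : Measurable fun p : α × α => p.1 ≠ p.2 := by fun_prop
  have hae : ∀ᵐ p ∂μ.prod ν, p.1 ≠ p.2 :=
    (Measure.ae_prod_iff_ae_ae (measurableSet_setOfPred.mpr hne)).mpr <| .of_forall fun x =>
      (ν.ae_ne x).mono fun _ => Ne.symm
  exact (hpair.ae_iff hne).mpr hae

end Distributions

end GLRT

theorem mainTheorem3 {Ω : Type*} [MeasurableSpace Ω] (P : Measure Ω) [IsProbabilityMeasure P]
    (n : ℕ) (hn : 2 ≤ n) (a : ℝ) (σ : ℝ≥0) (hσ : 0 < σ) (Y : Fin n → Ω → ℝ)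
    (hlaw : ∀ k, HasLaw (Y k) (gaussianReal a (σ ^ 2)) P) (hindep : iIndepFun Y P) :
    (∀ y : Fin n → ℝ, (∃ i j, y i ≠ y j) →
      BddAbove (GLRT.likelihood y '' GLRT.nullHypothesis) ∧
      BddAbove (GLRT.likelihood y '' GLRT.altHypothesis) ∧
      0 < GLRT.supLikelihood GLRT.nullHypothesis y ∧
      GLRT.statistic y =
        ((n : ℝ) - 1) * (GLRT.likelihoodRatio y ^ (2 / (n : ℝ)) - 1) ∧
      ∀ b : ℝ, 0 ≤ b →
        (b < GLRT.statistic y ↔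
          (1 + b / ((n : ℝ) - 1)) ^ ((n : ℝ) / 2) < GLRT.likelihoodRatio y)) ∧
    (∀ᵐ ω ∂P, ∃ i j, Y i ω ≠ Y j ω) ∧
    (a = 0 → HasLaw (fun ω => GLRT.statistic fun k => Y k ω) (GLRT.fisher 1 (n - 1)) P) ∧
    (a ≠ 0 → HasLaw (fun ω => GLRT.statistic fun k => Y k ω)
      (GLRT.noncentralFisher 1 (n - 1) ((n : ℝ) * a ^ 2 / (σ : ℝ) ^ 2)) P) := by
  have : NeZero n := ⟨by omega⟩
  have hstat := (GLRT.measurePreserving_statistic a hσ.ne').fun_comp_hasLaw (hindep.hasLaw_pi hlaw)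
  refine ⟨fun y hy => ⟨⟨_, (GLRT.isLUB_likelihood_nullHypothesis hy).1⟩,
    ⟨_, (GLRT.isLUB_likelihood_altHypothesis hy).1⟩, ?_,
    GLRT.statistic_eq_likelihoodRatio_rpow hy, fun b hb => GLRT.lt_statistic_iff hy hb⟩,
    ?_, ?_, fun _ => hstat⟩
  · rw [GLRT.supLikelihood_nullHypothesis hy]
    exact Real.exp_pos _
  · have := nullSingletonClass_gaussianReal (μ := a) (pow_ne_zero 2 hσ.ne')
    let i : Fin n := ⟨0, by omega⟩
    let j : Fin n := ⟨1, by omega⟩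
    have hij : i ≠ j := by simp [i, j]
    filter_upwards [GLRT.ae_ne_of_indepFun (hlaw i) (hlaw j) (hindep.indepFun hij)] with ω hω
    exact ⟨i, j, hω⟩
  · rintro rfl
    simpa [GLRT.noncentralFisher_zero] using hstat
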